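/- Let $p$ be an odd prime and let $F$ be a field of characteristic $p$. Let $\mathfrak b_2(F)$ be the $F$-vector space generated by symbols $\langle a\rangle$, $a\in F\setminus\{0,1\}$, subject to the relations $$\langle a\rangle-\langle b\rangle+a\left\langle \frac{b}{a}\right\rangle+(1-a)\left\langle\frac{1-b}{1-a}\right\rangle=0$$ for all $a,b\in F\setminus\{0,1\}$ with $a\neq b$. Then $\dim_F \mathfrak b_2(F)\geq 1$. If, moreover, $F$ is perfect, then $\mathfrak b_2(F)\cong F$ as $F$-vector spaces. -/

import Mathlib

/-- The doubly punctured affine line `F - {0, 1}`. -/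
abbrev DoublyPunctured (F : Type*) [Field F] : Type _ := {x : F // x ≠ 0 ∧ x ≠ 1}

namespace DoublyPunctured

/-- `b / a`, for distinct `a`, `b` in `F - {0, 1}`. -/
def quot {F : Type*} [Field F] (a b : DoublyPunctured F) (h : a ≠ b) : DoublyPunctured F :=
  ⟨(b : F) / (a : F), div_ne_zero b.2.1 a.2.1, fun e =>
    h (Subtype.ext ((div_eq_one_iff_eq a.2.1).1 e).symm)⟩

/-- `(1 - b) / (1 - a)`, for distinct `a`, `b` in `F - {0, 1}`. -/
def coquot {F : Type*} [Field F] (a b : DoublyPunctured F) (h : a ≠ b) : DoublyPunctured F :=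
  ⟨(1 - (b : F)) / (1 - (a : F)),
    div_ne_zero (sub_ne_zero.2 b.2.2.symm) (sub_ne_zero.2 a.2.2.symm), fun e =>
    h (Subtype.ext (sub_right_injective
      ((div_eq_one_iff_eq (sub_ne_zero.2 a.2.2.symm)).1 e)).symm)⟩

end DoublyPunctured

/-- The four-term element `[a] - [b] + a [b/a] + (1 - a) [(1-b)/(1-a)]` of the free `F`-vector
space on `F - {0, 1}`. -/
noncomputable def fourTerm {F : Type*} [Field F] (a b : DoublyPunctured F) (h : a ≠ b) :
    DoublyPunctured F →₀ F :=
  Finsupp.single a 1 - Finsupp.single b 1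
    + (a : F) • Finsupp.single (DoublyPunctured.quot a b h) 1
    + (1 - (a : F)) • Finsupp.single (DoublyPunctured.coquot a b h) 1

/-- The `F`-subspace spanned by all four-term elements. -/
noncomputable def fourTermRelations (F : Type*) [Field F] : Submodule F (DoublyPunctured F →₀ F) :=
  Submodule.span F {r | ∃ (a b : DoublyPunctured F) (h : a ≠ b), r = fourTerm a b h}

/-- The `F`-vector space `𝔟₂(F)`: generators `⟨a⟩` for `a` in `F - {0, 1}`, subject to the
four-term relations. -/
abbrev B2 (F : Type*) [Field F] : Type _ := (DoublyPunctured F →₀ F) ⧸ fourTermRelations F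

/-!
A homogeneous symmetric 2-cocycle `h` of the additive group of `F` yields the solution
`a ↦ h a (1 - a)` of the four-term equation, and when `2 ≠ 0` every solution arises in this way;
so linear maps out of `𝔟₂(F)` are the same as such cocycles. In characteristic `p` let `c` be the
element of `𝔟₂(F)` on which the functional attached to `h` takes the value
`∑ k < p, h k 1`, the obstruction to `p` killing the extension defined by `h`.

* `c ≠ 0`: the `p`-th root of `((x + y) ^ p - x ^ p - y ^ p) / p` is a homogeneous cocycle over a
  perfect closure, and there the sum telescopes to the `p`-th root of `(p ^ p - p) / p = -1`.
* `c` spans if `F` is perfect: modulo `c`, multiplication by `p` vanishes on the extension, on which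
  `F` acts multiplicatively with additivity defects of square zero. As Frobenius is additive on
  commuting endomorphisms, the defect of `s ^ p` and `t ^ p` is the `p`-th power of that of `s` and
  `t`, so all defects vanish, and they are the values of the cocycle.
-/

/-! ### Homogeneous cocycles -/

/-- Symmetric 2-cocycles of the additive group of `R` with values in an `R`-module which are
homogeneous of degree one. -/
structure IsHomogeneousCocycle {R V : Type*} [CommRing R] [AddCommGroup V] [Module R V]
    (h : R → R → V) : Prop where
  homogeneous : ∀ t x y, h (t * x) (t * y) = t • h x y
  comm : ∀ x y, h x y = h y x
  cocycle : ∀ x y z, h x y + h (x + y) z = h x (y + z) + h y z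

/-- The sum `h 0 1 + ⋯ + h (n - 1) 1`: the fiber coordinate of the `n`-th multiple of the lift
`(0, 1)` of `1` to the extension attached to a cocycle `h`. -/
def cocycleSum {R V : Type*} [Semiring R] [AddCommMonoid V] (h : R → R → V) (n : ℕ) : V :=
  ∑ k ∈ Finset.range n, h k 1

namespace IsHomogeneousCocycle

section

variable {R V : Type*} [CommRing R] [AddCommGroup V] [Module R V] {h : R → R → V}

theorem zero_left (hh : IsHomogeneousCocycle h) (x : R) : h 0 x = 0 := by
  have h00 : h 0 0 = 0 := by simpa using hh.homogeneous 0 0 0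
  simpa [h00] using (hh.cocycle 0 0 x).symm

theorem zero_right (hh : IsHomogeneousCocycle h) (x : R) : h x 0 = 0 := by
  rw [hh.comm, hh.zero_left]

theorem comp_linearMap {W : Type*} [AddCommGroup W] [Module R W] (hh : IsHomogeneousCocycle h)
    (φ : V →ₗ[R] W) : IsHomogeneousCocycle fun x y => φ (h x y) where
  homogeneous t x y := by rw [hh.homogeneous, map_smul]
  comm x y := by rw [hh.comm]
  cocycle x y z := by rw [← map_add, hh.cocycle, map_add]

theorem comp_algebraMap {A : Type*} [CommRing A] [Algebra A R] [Module A V]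
    [IsScalarTower A R V] (hh : IsHomogeneousCocycle h) :
    IsHomogeneousCocycle fun x y : A => h (algebraMap A R x) (algebraMap A R y) where
  homogeneous t x y := by rw [map_mul, map_mul, hh.homogeneous, algebraMap_smul]
  comm x y := hh.comm _ _
  cocycle x y z := by simp only [map_add, hh.cocycle]

end

theorem neg_right {F V : Type*} [Field F] [NeZero (2 : F)] [AddCommGroup V] [Module F V]
    {h : F → F → V} (hh : IsHomogeneousCocycle h) (x : F) : h x (-x) = 0 := by
  have hneg : h x (-x) = -h x (-x) := by
    simpa [hh.comm (-x) x] using hh.homogeneous (-1) x (-x)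
  have htwo : (2 : F) • h x (-x) = 0 := by
    rw [two_smul]
    exact eq_neg_iff_add_eq_zero.1 hneg
  exact (smul_eq_zero.1 htwo).resolve_left two_ne_zero

end IsHomogeneousCocycle

/-- The abelian extension of the additive group of `R` by `V` defined by a homogeneous cocycle
`h`, as the set `V × R` with addition twisted by `h`. -/
@[ext]
structure CocycleExtension {R V : Type*} [CommRing R] [AddCommGroup V] [Module R V]
    {h : R → R → V} (hh : IsHomogeneousCocycle h) where
  fiber : V
  base : R

namespace CocycleExtension

variable {R V : Type*} [CommRing R] [AddCommGroup V] [Module R V] {h : R → R → V}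
  {hh : IsHomogeneousCocycle h}

instance : Zero (CocycleExtension hh) := ⟨⟨0, 0⟩⟩

instance : Neg (CocycleExtension hh) := ⟨fun m => ⟨-m.fiber - h (-m.base) m.base, -m.base⟩⟩

instance : Add (CocycleExtension hh) :=
  ⟨fun m n => ⟨m.fiber + n.fiber + h m.base n.base, m.base + n.base⟩⟩

@[simp] theorem fiber_zero : (0 : CocycleExtension hh).fiber = 0 := rfl

@[simp] theorem base_zero : (0 : CocycleExtension hh).base = 0 := rfl

@[simp] theorem fiber_neg (m : CocycleExtension hh) :
    (-m).fiber = -m.fiber - h (-m.base) m.base := rfl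

@[simp] theorem base_neg (m : CocycleExtension hh) : (-m).base = -m.base := rfl

@[simp] theorem fiber_add (m n : CocycleExtension hh) :
    (m + n).fiber = m.fiber + n.fiber + h m.base n.base := rfl

@[simp] theorem base_add (m n : CocycleExtension hh) : (m + n).base = m.base + n.base := rfl

instance : AddCommGroup (CocycleExtension hh) :=
  { AddGroup.ofLeftAxioms (G := CocycleExtension hh)
      (fun a b c => by
        ext
        · simp only [fiber_add, base_add]
          linear_combination (norm := abel) hh.cocycle a.base b.base c.base
        · exact add_assoc _ _ _)
      (fun a => by ext <;> simp [hh.zero_left])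
      (fun a => by
        ext
        · simp only [fiber_add, fiber_neg, base_neg, fiber_zero]
          abel
        · exact neg_add_cancel a.base) with
    add_comm := fun a b => by
      ext
      · simp only [fiber_add, hh.comm a.base, add_comm a.fiber]
      · exact add_comm _ _ }

theorem nsmul_eq (n : ℕ) (m : CocycleExtension hh) :
    n • m = ⟨n • m.fiber + m.base • cocycleSum h n, n * m.base⟩ := by
  induction n with
  | zero => rw [zero_nsmul]; ext <;> simp [cocycleSum]
  | succ n ih =>
    rw [succ_nsmul, ih]
    ext
    · have hn : h (n * m.base) m.base = m.base • h n 1 := by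
        rw [← hh.homogeneous, mul_one, mul_comm]
      simp only [fiber_add, hn, cocycleSum, Finset.sum_range_succ, smul_add, succ_nsmul]
      abel
    · simp only [base_add, Nat.cast_succ, add_one_mul]

variable (hh) in
/-- The multiplicative action of the scalars on the extension; it is additive in the scalar only
up to the cocycle. -/
def scale : R →* AddMonoid.End (CocycleExtension hh) where
  toFun t :=
    { toFun := fun m => ⟨t • m.fiber, t * m.base⟩
      map_zero' := by ext <;> simp
      map_add' := fun m n => by ext <;> simp [hh.homogeneous, mul_add] }
  map_one' := AddMonoid.End.ext _ fun m =>
    CocycleExtension.ext (one_smul R m.fiber) (one_mul m.base)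
  map_mul' s t := AddMonoid.End.ext _ fun m =>
    CocycleExtension.ext (mul_smul s t m.fiber) (mul_assoc s t m.base)

@[simp] theorem fiber_scale (t : R) (m : CocycleExtension hh) :
    (scale hh t m).fiber = t • m.fiber := rfl

@[simp] theorem base_scale (t : R) (m : CocycleExtension hh) :
    (scale hh t m).base = t * m.base := rfl

theorem scale_add_scale_sub_scale_add (s t : R) (m : CocycleExtension hh) :
    (scale hh s + scale hh t - scale hh (s + t)) m = ⟨m.base • h s t, 0⟩ := by
  have hst : h (s * m.base) (t * m.base) = m.base • h s t := by
    rw [← hh.homogeneous, mul_comm s, mul_comm t]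
  change scale hh s m + scale hh t m - scale hh (s + t) m = _
  rw [sub_eq_iff_eq_add]
  ext
  · simp only [fiber_add, fiber_scale, base_scale, hh.zero_left, hst, add_smul, add_zero]
    abel
  · simp [add_mul]

theorem scale_defect_sq_eq_zero (s t : R) :
    (scale hh s + scale hh t - scale hh (s + t)) ^ 2 = 0 := by
  ext1 m
  rw [pow_two, AddMonoid.End.coe_mul, Function.comp_apply, scale_add_scale_sub_scale_add,
    scale_add_scale_sub_scale_add, zero_smul]
  rfl

theorem charP_end (p : ℕ) [Fact p.Prime] [CharP R p] (h0 : cocycleSum h p = 0) :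
    CharP (AddMonoid.End (CocycleExtension hh)) p := by
  have : Nontrivial R := CharP.nontrivial_of_char_ne_one (Fact.out : p.Prime).ne_one
  have : Nontrivial (AddMonoid.End (CocycleExtension hh)) :=
    ⟨1, 0, fun e => one_ne_zero (congrArg base (DFunLike.congr_fun e ⟨0, 1⟩))⟩
  refine (CharP.charP_iff_prime_eq_zero Fact.out).2 (AddMonoid.End.ext _ fun m => ?_)
  rw [AddMonoid.End.natCast_apply, nsmul_eq, h0]
  ext <;> simp [← Nat.cast_smul_eq_nsmul R]

end CocycleExtension

theorem map_add_of_defect_pow_eq_zero {R S : Type*} [CommSemiring R] [Ring S] (p : ℕ)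
    [Fact p.Prime] [ExpChar R p] [PerfectRing R p] [CharP S p] (ρ : R →* S) {n : ℕ}
    (hn : ∀ a b, (ρ a + ρ b - ρ (a + b)) ^ n = 0) (a b : R) : ρ (a + b) = ρ a + ρ b := by
  obtain ⟨u, rfl⟩ := (bijective_iterateFrobenius R p n).surjective a
  obtain ⟨v, rfl⟩ := (bijective_iterateFrobenius R p n).surjective b
  have hcomm : ∀ s t, Commute (ρ s) (ρ t) := fun s t => (Commute.all s t).map ρ
  have hpow : (ρ u + ρ v - ρ (u + v)) ^ p ^ n = 0 :=
    pow_eq_zero_of_le (Nat.lt_pow_self (Fact.out : p.Prime).one_lt).le (hn u v)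
  rw [sub_pow_char_pow_of_commute _ _ ((hcomm _ _).add_left (hcomm _ _)),
    add_pow_char_pow_of_commute _ _ (hcomm _ _), sub_eq_zero] at hpow
  rw [← map_add]
  simpa only [iterateFrobenius_def, map_pow] using hpow.symm

theorem IsHomogeneousCocycle.eq_zero_of_cocycleSum_eq_zero {R V : Type*} [CommRing R]
    [AddCommGroup V] [Module R V] {h : R → R → V} (hh : IsHomogeneousCocycle h) (p : ℕ)
    [Fact p.Prime] [CharP R p] [PerfectRing R p] (h0 : cocycleSum h p = 0) (x y : R) :
    h x y = 0 := by
  have := CocycleExtension.charP_end (hh := hh) p h0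
  have hadd := map_add_of_defect_pow_eq_zero p (CocycleExtension.scale hh)
    CocycleExtension.scale_defect_sq_eq_zero x y
  have hdefect := CocycleExtension.scale_add_scale_sub_scale_add (hh := hh) x y ⟨0, 1⟩
  rw [hadd, sub_self] at hdefect
  simpa using (congrArg CocycleExtension.fiber hdefect).symm

/-! ### The Frobenius cocycle -/

/-- The value at `(x, y)` of the integral polynomial `((X + Y) ^ p - X ^ p - Y ^ p) / p`, for `p`
prime. The natural-number division in the coefficients is exact. -/
def frobeniusDefect {R : Type*} [CommSemiring R] (p : ℕ) (x y : R) : R :=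
  ∑ k ∈ Finset.Ioo 0 p, x ^ k * y ^ (p - k) * ((p.choose k / p : ℕ) : R)

section

variable {R : Type*} [CommRing R] (p : ℕ)

theorem map_frobeniusDefect {S : Type*} [CommRing S] (φ : R →+* S) (x y : R) :
    φ (frobeniusDefect p x y) = frobeniusDefect p (φ x) (φ y) := by
  simp [frobeniusDefect]

theorem frobeniusDefect_mul (t x y : R) :
    frobeniusDefect p (t * x) (t * y) = t ^ p * frobeniusDefect p x y := by
  rw [frobeniusDefect, frobeniusDefect, Finset.mul_sum]
  refine Finset.sum_congr rfl fun k hk => ?_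
  rw [← pow_mul_pow_sub t (Finset.mem_Ioo.1 hk).2.le]
  ring

variable {p} (hp : p.Prime)

include hp

theorem mul_frobeniusDefect (x y : R) :
    p * frobeniusDefect p x y = (x + y) ^ p - x ^ p - y ^ p := by
  rw [add_pow_prime_eq' hp, frobeniusDefect]
  ring

theorem frobeniusDefect_comm (x y : R) : frobeniusDefect p x y = frobeniusDefect p y x := by
  have hp0 : (p : MvPolynomial R ℤ) ≠ 0 := Nat.cast_ne_zero.2 hp.ne_zero
  have huniv (X Y : MvPolynomial R ℤ) : frobeniusDefect p X Y = frobeniusDefect p Y X := by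
    apply mul_left_cancel₀ hp0
    rw [mul_frobeniusDefect hp, mul_frobeniusDefect hp, add_comm X]
    ring
  simpa only [map_frobeniusDefect, MvPolynomial.eval₂Hom_X', id] using
    congrArg (MvPolynomial.eval₂Hom (Int.castRingHom R) id)
      (huniv (MvPolynomial.X x) (MvPolynomial.X y))

theorem frobeniusDefect_cocycle (x y z : R) :
    frobeniusDefect p x y + frobeniusDefect p (x + y) z =
      frobeniusDefect p x (y + z) + frobeniusDefect p y z := by
  have hp0 : (p : MvPolynomial R ℤ) ≠ 0 := Nat.cast_ne_zero.2 hp.ne_zero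
  have huniv (X Y Z : MvPolynomial R ℤ) :
      frobeniusDefect p X Y + frobeniusDefect p (X + Y) Z =
        frobeniusDefect p X (Y + Z) + frobeniusDefect p Y Z := by
    apply mul_left_cancel₀ hp0
    simp only [mul_add, mul_frobeniusDefect hp, add_assoc]
    ring
  simpa only [map_add, map_frobeniusDefect, MvPolynomial.eval₂Hom_X', id] using
    congrArg (MvPolynomial.eval₂Hom (Int.castRingHom R) id)
      (huniv (MvPolynomial.X x) (MvPolynomial.X y) (MvPolynomial.X z))

theorem cocycleSum_frobeniusDefect :
    cocycleSum (frobeniusDefect (R := R) p) p = (p : R) ^ (p - 1) - 1 := by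
  have hint : cocycleSum (frobeniusDefect (R := ℤ) p) p = (p : ℤ) ^ (p - 1) - 1 := by
    apply mul_left_cancel₀ (Nat.cast_ne_zero.2 hp.ne_zero : (p : ℤ) ≠ 0)
    have htele (n : ℕ) :
        ∑ k ∈ Finset.range n, (((k : ℤ) + 1) ^ p - (k : ℤ) ^ p) = (n : ℤ) ^ p := by
      simpa [zero_pow hp.ne_zero] using Finset.sum_range_sub (fun k : ℕ => (k : ℤ) ^ p) n
    calc (p : ℤ) * cocycleSum (frobeniusDefect p) p
      _ = ∑ k ∈ Finset.range p, (((k : ℤ) + 1) ^ p - (k : ℤ) ^ p - 1) := by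
        simp only [cocycleSum, Finset.mul_sum, mul_frobeniusDefect hp, one_pow]
      _ = (p : ℤ) ^ p - p := by rw [Finset.sum_sub_distrib, htele]; simp
      _ = p * ((p : ℤ) ^ (p - 1) - 1) := by
        rw [mul_sub_one, mul_pow_sub_one hp.ne_zero]
  simpa only [cocycleSum, map_sum, map_frobeniusDefect, map_sub, map_pow, map_natCast, map_one]
    using congrArg (Int.castRingHom R) hint

end

/-- The `p`-th root of `frobeniusDefect`, which is homogeneous of degree one rather than `p`. -/
noncomputable def frobeniusCocycle (R : Type*) [CommSemiring R] (p : ℕ) [ExpChar R p]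
    [PerfectRing R p] (x y : R) : R :=
  (frobeniusEquiv R p).symm (frobeniusDefect p x y)

section

variable (R : Type*) [CommRing R] (p : ℕ) [Fact p.Prime] [CharP R p] [PerfectRing R p]

theorem isHomogeneousCocycle_frobeniusCocycle :
    IsHomogeneousCocycle (frobeniusCocycle R p) where
  homogeneous t x y := by
    rw [frobeniusCocycle, frobeniusDefect_mul, map_mul, ← frobenius_def,
      frobeniusEquiv_symm_apply_frobenius, smul_eq_mul, frobeniusCocycle]
  comm x y := by rw [frobeniusCocycle, frobeniusDefect_comm Fact.out, frobeniusCocycle]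
  cocycle x y z := by
    simp only [frobeniusCocycle, ← map_add, frobeniusDefect_cocycle Fact.out]

theorem cocycleSum_frobeniusCocycle : cocycleSum (frobeniusCocycle R p) p = -1 := by
  have hp : p.Prime := Fact.out
  calc cocycleSum (frobeniusCocycle R p) p
    _ = (frobeniusEquiv R p).symm (cocycleSum (frobeniusDefect p) p) := by
      simp only [cocycleSum, frobeniusCocycle, map_sum]
    _ = -1 := by
      rw [cocycleSum_frobeniusDefect hp, CharP.cast_eq_zero,
        zero_pow (Nat.sub_pos_of_lt hp.one_lt).ne', zero_sub, map_neg, map_one]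

end

/-! ### The four-term equation -/

/-- Solutions of the four-term equation on `F - {0, 1}`, extended by zero to `0` and `1`. -/
structure IsFourTermSolution {F V : Type*} [Field F] [AddCommGroup V] [Module F V]
    (f : F → V) : Prop where
  map_zero : f 0 = 0
  map_one : f 1 = 0
  fourTerm : ∀ a b : DoublyPunctured F, a ≠ b →
    f a - f b + (a : F) • f (b / a) + (1 - (a : F)) • f ((1 - b) / (1 - a)) = 0

/-- The homogeneous function of degree one in two variables which restricts to
`f a` at `(a, 1 - a)`. It vanishes on the line `x + y = 0`. -/
def homogenize {F V : Type*} [Field F] [SMul F V] (f : F → V) (x y : F) : V :=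
  (x + y) • f (x / (x + y))

section

variable {F V : Type*} [Field F] [AddCommGroup V] [Module F V]

theorem homogenize_mul (f : F → V) (t x y : F) :
    homogenize f (t * x) (t * y) = t • homogenize f x y := by
  rcases eq_or_ne t 0 with rfl | ht
  · simp [homogenize]
  · rw [homogenize, ← mul_add, mul_div_mul_left _ _ ht, mul_smul, homogenize]

theorem homogenize_neg_right (f : F → V) (x : F) : homogenize f x (-x) = 0 := by
  simp [homogenize]

namespace IsHomogeneousCocycle

variable [NeZero (2 : F)] {h : F → F → V}

theorem isFourTermSolution (hh : IsHomogeneousCocycle h) :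
    IsFourTermSolution fun a => h a (1 - a) where
  map_zero := hh.zero_left _
  map_one := by rw [sub_self, hh.zero_right]
  fourTerm := by
    rintro ⟨a, a0, a1⟩ ⟨b, -, -⟩ -
    have ha : 1 - a ≠ 0 := sub_ne_zero.2 a1.symm
    have hquot : a • h (b / a) (1 - b / a) = h b (a - b) := by
      rw [← hh.homogeneous]
      congr 1 <;> field_simp
    have hcoquot : (1 - a) • h ((1 - b) / (1 - a)) (1 - (1 - b) / (1 - a)) =
        h (b - a) (1 - b) := by
      rw [← hh.homogeneous, hh.comm]
      congr 1 <;> field_simp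
      ring
    have h₁ := hh.cocycle b (a - b) (1 - a)
    have h₂ := hh.cocycle (b - a) (a - b) (1 - a)
    have h₃ : h (b - a) (a - b) = 0 := by rw [← neg_sub b a, hh.neg_right]
    simp only [add_sub_cancel, sub_add_sub_cancel', sub_self, hh.zero_left, h₃] at h₁ h₂
    simp only [hquot, hcoquot]
    linear_combination (norm := abel) h₁ - h₂

theorem homogenize_eq (hh : IsHomogeneousCocycle h) (x y : F) :
    homogenize (fun a => h a (1 - a)) x y = h x y := by
  rcases eq_or_ne (x + y) 0 with hxy | hxy
  · rw [eq_neg_of_add_eq_zero_right hxy, homogenize_neg_right, hh.neg_right]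
  · rw [homogenize, ← hh.homogeneous]
    congr 1 <;> field_simp
    ring

end IsHomogeneousCocycle

namespace IsFourTermSolution

variable {f : F → V}

theorem fourTerm_one_sub (hf : IsFourTermSolution f) (a : F) :
    f a - f (1 - a) + a • f ((1 - a) / a) + (1 - a) • f (a / (1 - a)) = 0 := by
  by_cases a0 : a = 0
  · simp [a0, hf.map_zero, hf.map_one]
  by_cases a1 : a = 1
  · simp [a1, hf.map_zero, hf.map_one]
  by_cases ha : a = 1 - a
  · simp [← ha, a0, hf.map_one]
  have h := hf.fourTerm ⟨a, a0, a1⟩ ⟨1 - a, sub_ne_zero.2 (Ne.symm a1), by simpa using a0⟩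
    fun e => ha (congrArg Subtype.val e)
  simpa only [sub_sub_cancel] using h

variable [NeZero (2 : F)]

theorem map_one_sub (hf : IsFourTermSolution f) (a : F) : f (1 - a) = f a := by
  have h₁ := hf.fourTerm_one_sub a
  have h₂ := hf.fourTerm_one_sub (1 - a)
  rw [sub_sub_cancel] at h₂
  have htwo : (2 : F) • (f (1 - a) - f a) = 0 := by
    linear_combination (norm := module) h₂ - h₁
  exact sub_eq_zero.1 ((smul_eq_zero.1 htwo).resolve_left two_ne_zero)

theorem homogenize_comm (hf : IsFourTermSolution f) (x y : F) :
    homogenize f x y = homogenize f y x := by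
  rcases eq_or_ne (x + y) 0 with h | h
  · rw [homogenize, homogenize, add_comm y, h, zero_smul, zero_smul]
  · rw [homogenize, ← hf.map_one_sub, one_sub_div h, add_sub_cancel_left, add_comm x, homogenize]

theorem smul_map_inv (hf : IsFourTermSolution f) (y : F) : y • f y⁻¹ = -f y := by
  rcases eq_or_ne (1 + y) 0 with hy | hy
  · rw [← neg_eq_of_add_eq_zero_right hy, inv_neg, inv_one, neg_one_smul]
  have hsub : 1 - (1 + y)⁻¹ = (1 + y)⁻¹ * y := by field_simp; ring
  have h := hf.fourTerm_one_sub (1 + y)⁻¹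
  rw [hf.map_one_sub, sub_self, zero_add, hsub, mul_div_cancel_left₀ _ (inv_ne_zero hy),
    div_mul_cancel_left₀ (inv_ne_zero hy), mul_smul, ← smul_add] at h
  exact eq_neg_of_add_eq_zero_right ((smul_eq_zero.1 h).resolve_left (inv_ne_zero hy))

theorem homogenize_add_neg (hf : IsFourTermSolution f) (x y : F) :
    homogenize f (x + y) (-y) = -homogenize f x y := by
  rcases eq_or_ne (x + y) 0 with hxy | hxy
  · simp [homogenize, hxy, hf.map_zero]
  have h := congrArg ((x + y) • ·) (hf.smul_map_inv (x / (x + y)))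
  simpa [homogenize, smul_smul, mul_div_cancel₀ _ hxy] using h

theorem fourTerm_homogenize (hf : IsFourTermSolution f) (a b : F) :
    homogenize f a (1 - a) - homogenize f b (1 - b) + homogenize f b (a - b)
      + homogenize f (1 - b) (b - a) = 0 := by
  suffices f a - f b + a • f (b / a) + (1 - a) • f ((1 - b) / (1 - a)) = 0 by
    simpa [homogenize]
  by_cases a0 : a = 0
  · simp [a0, hf.map_zero, hf.map_one_sub]
  by_cases a1 : a = 1
  · simp [a1, hf.map_one]
  by_cases b0 : b = 0
  · have := hf.smul_map_inv (1 - a)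
    simp [b0, hf.map_zero, this, hf.map_one_sub]
  by_cases b1 : b = 1
  · have := hf.smul_map_inv a
    simp [b1, hf.map_zero, hf.map_one, this]
  by_cases hab : a = b
  · rw [← hab, div_self a0, div_self (sub_ne_zero.2 (Ne.symm a1))]
    simp [hf.map_one]
  exact hf.fourTerm ⟨a, a0, a1⟩ ⟨b, b0, b1⟩ fun e => hab (congrArg Subtype.val e)

theorem homogenize_cocycle_of_add_eq_one (hf : IsFourTermSolution f) {x y z : F}
    (hs : x + y + z = 1) :
    homogenize f x y + homogenize f (x + y) z = homogenize f x (y + z) + homogenize f y z := by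
  obtain rfl : z = 1 - (x + y) := by rw [← hs, add_sub_cancel_left]
  have hx : 1 - (x + y) + y = 1 - x := by ring
  have h₁ := hf.fourTerm_homogenize (x + y) x
  have h₂ := hf.homogenize_add_neg (1 - (x + y)) y
  rw [hx] at h₂
  rw [add_sub_cancel_left, sub_add_cancel_left, h₂, hf.homogenize_comm (1 - (x + y)) y] at h₁
  rw [add_comm y, hx]
  linear_combination (norm := abel) h₁

theorem isHomogeneousCocycle_homogenize (hf : IsFourTermSolution f) :
    IsHomogeneousCocycle (homogenize f) where
  homogeneous := homogenize_mul f
  comm := hf.homogenize_comm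
  cocycle x y z := by
    rcases eq_or_ne (x + y + z) 0 with hs | hs
    · obtain rfl : x = -(y + z) := by linear_combination hs
      have hyz : homogenize f (-(y + z)) y = homogenize f y z := by
        have hneg := homogenize_mul f (-1) (y + z) (-y)
        rwa [neg_one_mul, neg_one_mul, neg_neg, neg_one_smul, add_comm y, hf.homogenize_add_neg,
          neg_neg, hf.homogenize_comm z, add_comm z] at hneg
      rw [hyz, neg_add_rev, neg_add_cancel_right, ← neg_add_rev, hf.homogenize_comm (-z),
        hf.homogenize_comm _ (y + z), homogenize_neg_right, homogenize_neg_right, add_zero,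
        zero_add]
    · have h := congrArg ((x + y + z) • ·) (hf.homogenize_cocycle_of_add_eq_one
        (x := x / (x + y + z)) (y := y / (x + y + z)) (z := z / (x + y + z))
        (by rw [← add_div, ← add_div, div_self hs]))
      simpa only [smul_add, ← homogenize_mul, ← add_div, mul_div_cancel₀ _ hs] using h

end IsFourTermSolution

end

/-! ### The space `𝔟₂(F)` -/

namespace B2

variable {F : Type*} [Field F]

open Classical in
/-- The class `⟨a⟩` in `𝔟₂(F)`, with `⟨0⟩ = ⟨1⟩ = 0`. -/
noncomputable def symbol (a : F) : B2 F :=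
  if h : a ≠ 0 ∧ a ≠ 1 then Submodule.Quotient.mk (Finsupp.single ⟨a, h⟩ 1) else 0

theorem symbol_coe (a : DoublyPunctured F) :
    symbol (a : F) = Submodule.Quotient.mk (Finsupp.single a 1) :=
  dif_pos a.2

variable (F) in
theorem isFourTermSolution_symbol : IsFourTermSolution (symbol : F → B2 F) where
  map_zero := by simp [symbol]
  map_one := by simp [symbol]
  fourTerm a b hab := by
    have hr : fourTerm a b hab ∈ fourTermRelations F := Submodule.subset_span ⟨a, b, hab, rfl⟩
    have hmk := (Submodule.Quotient.mk_eq_zero _).2 hr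
    simp only [fourTerm, Submodule.Quotient.mk_add, Submodule.Quotient.mk_sub,
      Submodule.Quotient.mk_smul, ← symbol_coe] at hmk
    exact hmk

variable (F) in
theorem span_range_symbol : Submodule.span F (Set.range (symbol : F → B2 F)) = ⊤ := by
  refine eq_top_iff.2 fun v _ => ?_
  obtain ⟨w, rfl⟩ := Submodule.Quotient.mk_surjective _ v
  induction w using Finsupp.induction_linear with
  | zero => exact Submodule.zero_mem _
  | add x y hx hy => exact Submodule.add_mem _ (hx trivial) (hy trivial)
  | single a r =>
    rw [← mul_one r, ← smul_eq_mul, ← Finsupp.smul_single, Submodule.Quotient.mk_smul,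
      ← symbol_coe]
    exact Submodule.smul_mem _ _ (Submodule.subset_span ⟨_, rfl⟩)

section

variable {V : Type*} [AddCommGroup V] [Module F V] {f : F → V}

theorem fourTermRelations_le_ker (hf : IsFourTermSolution f) :
    fourTermRelations F ≤
      (Finsupp.linearCombination F fun a : DoublyPunctured F => f a).ker := by
  rw [fourTermRelations, Submodule.span_le]
  rintro _ ⟨a, b, h, rfl⟩
  simp only [fourTerm, SetLike.mem_coe, LinearMap.mem_ker, map_add, map_sub, map_smul,
    Finsupp.linearCombination_single, one_smul]
  exact hf.fourTerm a b h

/-- The linear map `⟨a⟩ ↦ f a` defined by a solution `f` of the four-term equation. -/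
noncomputable def lift (hf : IsFourTermSolution f) : B2 F →ₗ[F] V :=
  (fourTermRelations F).liftQ _ (fourTermRelations_le_ker hf)

theorem lift_symbol (hf : IsFourTermSolution f) (a : F) : lift hf (symbol a) = f a := by
  by_cases ha : a ≠ 0 ∧ a ≠ 1
  · rw [symbol, dif_pos ha, lift, Submodule.liftQ_apply, Finsupp.linearCombination_single,
      one_smul]
  · rw [symbol, dif_neg ha, map_zero]
    rcases not_and_or.1 ha with ha | ha
    · rw [not_not.1 ha, hf.map_zero]
    · rw [not_not.1 ha, hf.map_one]

theorem lift_cocycleSum (hf : IsFourTermSolution f) (n : ℕ) :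
    lift hf (cocycleSum (homogenize symbol) n) = cocycleSum (homogenize f) n := by
  simp only [cocycleSum, homogenize, map_sum, map_smul, lift_symbol]

end

variable (F) (p : ℕ) [Fact p.Prime] [CharP F p] [NeZero (2 : F)]

theorem cocycleSum_ne_zero : cocycleSum (homogenize (symbol : F → B2 F)) p ≠ 0 := by
  let K := AlgebraicClosure F
  have : CharP K p := charP_of_injective_algebraMap (algebraMap F K).injective p
  have hh := (isHomogeneousCocycle_frobeniusCocycle K p).comp_algebraMap (A := F)
  intro h0
  have hlift := lift_cocycleSum hh.isFourTermSolution p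
  have hsum : cocycleSum (fun x y => frobeniusCocycle K p (algebraMap F K x) (algebraMap F K y)) p =
      -1 := by
    simpa only [cocycleSum, map_natCast, map_one] using cocycleSum_frobeniusCocycle K p
  rw [h0, map_zero, funext₂ hh.homogenize_eq, hsum] at hlift
  exact neg_ne_zero.2 one_ne_zero hlift.symm

theorem span_cocycleSum [PerfectRing F p] :
    Submodule.span F {cocycleSum (homogenize (symbol : F → B2 F)) p} = ⊤ := by
  set c := cocycleSum (homogenize (symbol : F → B2 F)) p
  have hh := (isFourTermSolution_symbol F).isHomogeneousCocycle_homogenize.comp_linearMap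
    (Submodule.span F {c}).mkQ
  have hzero := hh.eq_zero_of_cocycleSum_eq_zero p (by
    simp only [cocycleSum, ← map_sum]
    exact (Submodule.Quotient.mk_eq_zero _).2 (Submodule.mem_span_singleton_self c))
  rw [eq_top_iff, ← span_range_symbol, Submodule.span_le]
  rintro _ ⟨a, rfl⟩
  simpa [homogenize] using (Submodule.Quotient.mk_eq_zero _).1 (hzero a (1 - a))

end B2

theorem corollary4p10 {F : Type*} [Field F] (p : ℕ) (hp : p.Prime) (hp2 : p ≠ 2) [CharP F p] :
    1 ≤ Module.rank F (B2 F) ∧ (PerfectField F → Nonempty (B2 F ≃ₗ[F] F)) := by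
  have : Fact p.Prime := ⟨hp⟩
  have : NeZero (2 : F) := ⟨Ring.two_ne_zero (by rwa [ringChar.eq F p])⟩
  have hc := B2.cocycleSum_ne_zero F p
  have : Nontrivial (B2 F) := nontrivial_of_ne _ _ hc
  refine ⟨Cardinal.one_le_iff_pos.2 rank_pos, fun _ => ⟨LinearEquiv.symm ?_⟩⟩
  exact LinearEquiv.toSpanNonzeroSingleton F (B2 F) _ hc ≪≫ₗ
    LinearEquiv.ofTop _ (B2.span_cocycleSum F p)
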